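/- A set $S\subseteq\mathbb{R}^k$ is *basic semi-algebraic* if $S=\{x\in\mathbb{R}^k : p(x)=0,\ q_j(x)>0 \text{ for all } j\in J\}$ with $J$ finite and $p,q_j$ real polynomials; it is *semi-algebraic* if it is a finite union of basic semi-algebraic sets. A function $h:\mathbb{R}^n\to\mathbb{R}\cup\{\pm\infty\}$ is *(extended-real-valued) semi-algebraic* if the sets $\mathrm{dom}(h)=\{x : h(x)\in\mathbb{R}\}$, $\{x : h(x)=+\infty\}$, $\{x : h(x)=-\infty\}$ are semi-algebraic in $\mathbb{R}^n$ and the graph $\{(x,h(x)) : x\in\mathrm{dom}(h)\}$ is semi-algebraic in $\mathbb{R}^{n+1}$. Let $\mathcal{SA}$ be the class of these functions. For real polynomials $P,Q$ in $(x,y)\in\mathbb{R}^n\times\mathbb{R}^m$ and a set $\mathcal{Y}\subseteq\mathbb{R}^m$, let $\Theta(x)=\{y\in\mathcal{Y} : Q(x,y)\le Q(x,y') \text{ for all } y'\in\mathcal{Y}\}$. The *optimistic* and *pessimistic value functions* of the polynomial bilevel problem $(P,Q,\mathcal{Y})$ are $$\varphi_o(x)=\inf_{y\in\Theta(x)}P(x,y),\qquad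 \varphi_p(x)=\sup_{y\in\Theta(x)}P(x,y),$$ with values in $\mathbb{R}\cup\{\pm\infty\}$, where $\varphi_o(x)=+\infty$ and $\varphi_p(x)=-\infty$ if $\Theta(x)=\emptyset$. A *box* is a set $\mathcal{Y}=\{y\in\mathbb{R}^m : a_i\le y_i\le b_i,\ 1\le i\le m\}$ with $a_i,b_i\in\mathbb{R}\cup\{\pm\infty\}$; it is called *unbounded* if $a_i=-\infty$ or $b_i=+\infty$ for some $i$. Let $\mathcal{P}^{\mathrm{optim}}_{\mathrm{unbound}}$ (respectively $\mathcal{P}^{\mathrm{pessim}}_{\mathrm{unbound}}$) be the class of functions $h:\mathbb{R}^n\to\mathbb{R}\cup\{\pm\infty\}$ such that $h=\varphi_o$ (respectively $h=\varphi_p$) for some $m$, some polynomials $P,Q$ and some unbounded box $\mathcal{Y}\subseteq\mathbb{R}^m$. **Theorem (Value functions of polynomial bilevel programming).** Let $n\ge 0$. Every $h\in\mathcal{SA}$ on $\mathbb{R}^n$ is the optimistic value function of some polynomial bilevel problem whose lower level is unconstrained, i.e. $\mathcal{Y}=\mathbb{R}^m$ with $m\ge 1$, and is also the pessimistic value function of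 some (in general different) such problem. Moreover, $$\mathcal{P}^{\mathrm{optim}}_{\mathrm{unbound}}=\mathcal{P}^{\mathrm{pessim}}_{\mathrm{unbound}}=\mathcal{SA}.$$ -/

import Mathlib

namespace PolyBilevel

/-- Basic semi-algebraic subsets of `ℝ^σ` (`σ` is a finite index type in all uses below):
one polynomial equation and finitely many (possibly zero) strict polynomial inequalities. -/
def IsBasicSemialgebraic {σ : Type} (S : Set (σ → ℝ)) : Prop :=
  ∃ (k : ℕ) (P : MvPolynomial σ ℝ) (Q : Fin k → MvPolynomial σ ℝ),
    S = {x | MvPolynomial.eval x P = 0 ∧ ∀ j, 0 < MvPolynomial.eval x (Q j)}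

/-- Semi-algebraic sets: finite unions of basic semi-algebraic sets. -/
def IsSemialgebraic {σ : Type} (S : Set (σ → ℝ)) : Prop :=
  ∃ (N : ℕ) (B : Fin N → Set (σ → ℝ)), (∀ i, IsBasicSemialgebraic (B i)) ∧ S = ⋃ i, B i

/-- A function `f : U ⊆ ℝⁿ → ℝᵐ` is semi-algebraic if its graph is a semi-algebraic subset of
`ℝⁿ × ℝᵐ`, a point `(x, y)` of which is written `Sum.elim x y`. -/
def IsSemialgebraicFun {n m : ℕ} {U : Set (Fin n → ℝ)} (f : U → (Fin m → ℝ)) : Prop :=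
  IsSemialgebraic {p : Fin n ⊕ Fin m → ℝ | ∃ x : U, p = Sum.elim (x : Fin n → ℝ) (f x)}

/-- The set where `f` is finite. -/
def dom {n : ℕ} (f : (Fin n → ℝ) → EReal) : Set (Fin n → ℝ) := {x | f x ≠ ⊤ ∧ f x ≠ ⊥}

/-- The set where `f = +∞`. -/
def domPlus {n : ℕ} (f : (Fin n → ℝ) → EReal) : Set (Fin n → ℝ) := {x | f x = ⊤}

/-- The set where `f = -∞`. -/
def domMinus {n : ℕ} (f : (Fin n → ℝ) → EReal) : Set (Fin n → ℝ) := {x | f x = ⊥}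

/-- The class of extended-real-valued semi-algebraic functions on `ℝⁿ`. The restriction of `f`
to `dom f` is regarded as a map into `ℝ¹`; `EReal.toReal` is only applied to finite values. -/
def SA (n : ℕ) : Set ((Fin n → ℝ) → EReal) :=
  {f | IsSemialgebraic (dom f) ∧ IsSemialgebraic (domPlus f) ∧ IsSemialgebraic (domMinus f) ∧
    IsSemialgebraicFun (U := dom f) (m := 1) (fun x _ => (f x).toReal)}

/-- The lower-level solution set `Θ(x) = argmin_{y ∈ Y} Q(x, y)`. -/
def lowerArgmin {n m : ℕ} (Q : MvPolynomial (Fin n ⊕ Fin m) ℝ) (Y : Set (Fin m → ℝ))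
    (x : Fin n → ℝ) : Set (Fin m → ℝ) :=
  {y | y ∈ Y ∧ ∀ y' ∈ Y,
    MvPolynomial.eval (Sum.elim x y) Q ≤ MvPolynomial.eval (Sum.elim x y') Q}

/-- The optimistic value function `x ↦ inf_{y ∈ Θ(x)} P(x, y)`, equal to `+∞` if `Θ(x) = ∅`. -/
noncomputable def optimisticValue {n m : ℕ} (P Q : MvPolynomial (Fin n ⊕ Fin m) ℝ)
    (Y : Set (Fin m → ℝ)) (x : Fin n → ℝ) : EReal :=
  ⨅ y ∈ lowerArgmin Q Y x, ((MvPolynomial.eval (Sum.elim x y) P : ℝ) : EReal)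

/-- The pessimistic value function `x ↦ sup_{y ∈ Θ(x)} P(x, y)`, equal to `-∞` if `Θ(x) = ∅`. -/
noncomputable def pessimisticValue {n m : ℕ} (P Q : MvPolynomial (Fin n ⊕ Fin m) ℝ)
    (Y : Set (Fin m → ℝ)) (x : Fin n → ℝ) : EReal :=
  ⨆ y ∈ lowerArgmin Q Y x, ((MvPolynomial.eval (Sum.elim x y) P : ℝ) : EReal)

/-- The box `[a₁, b₁] × ⋯ × [aₘ, bₘ]` in `ℝᵐ`, with endpoints in `ℝ ∪ {±∞}`. -/
def box {m : ℕ} (a b : Fin m → EReal) : Set (Fin m → ℝ) :=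
  {y | ∀ i, a i ≤ (y i : EReal) ∧ (y i : EReal) ≤ b i}

/-- The box with endpoints `a`, `b` is unbounded: some `aᵢ = -∞` or some `bᵢ = +∞`. -/
def IsUnboundedBox {m : ℕ} (a b : Fin m → EReal) : Prop := ∃ i, a i = ⊥ ∨ b i = ⊤

/-- Optimistic value functions on `ℝⁿ` of polynomial bilevel problems whose lower-level feasible
set is an unbounded box. -/
def POptimUnbound (n : ℕ) : Set ((Fin n → ℝ) → EReal) :=
  {h | ∃ (m : ℕ) (P Q : MvPolynomial (Fin n ⊕ Fin m) ℝ) (a b : Fin m → EReal),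
    IsUnboundedBox a b ∧ optimisticValue P Q (box a b) = h}

/-- Pessimistic value functions on `ℝⁿ` of polynomial bilevel problems whose lower-level feasible
set is an unbounded box. -/
def PPessimUnbound (n : ℕ) : Set ((Fin n → ℝ) → EReal) :=
  {h | ∃ (m : ℕ) (P Q : MvPolynomial (Fin n ⊕ Fin m) ℝ) (a b : Fin m → EReal),
    IsUnboundedBox a b ∧ pessimisticValue P Q (box a b) = h}

end PolyBilevel

/-! Value functions are semi-algebraic because membership in `Θ(x)` and the condition `φ_o(x) < t`
are first-order conditions on polynomials, so quantifier elimination applies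
(`optimisticValue_mem_SA`).

Conversely, write the graph of `h` together with `{h = -∞} × ℝ` as the projection of the zero set of
a polynomial `F(x, t, w) ≥ 0`, and take `Q = F · ((uv - 1)² + u²)`, `P = t`. The second factor is
positive with unattained infimum `0`, so a point with `F > 0` never minimizes `Q`, while a point
with `F = 0` always does. Thus `Θ(x)` is cut out by `F = 0`: it is empty where `h = +∞`, forces `t =
h(x)` where `h` is finite, and leaves `t` free where `h = -∞` (`exists_optimisticValue_eq`). The
pessimistic case follows by negating `P` and `h`.

Quantifier elimination is proved in the style of Cohen and Hörmander. A set is semi-algebraic iff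
membership depends only on the signs of finitely many polynomials. If two parameter points agree in
sign on a suitable finite family, an increasing bijection of the line matches the sign patterns on
their fibres (`exists_signDetermined`); it carries a witness in one fibre to a witness in the other.
-/

namespace PolyBilevel

open Polynomial

/-! ### Matching sign patterns by increasing bijections of the line -/

/-- An increasing bijection of the line that moves `a` to `b` inside `(l, r)` and is the identity
outside. -/
lemma exists_orderIso_apply_eq {l r a b : ℝ} (hla : l < a) (har : a < r) (hlb : l < b)
    (hbr : b < r) : ∃ χ : ℝ ≃o ℝ, χ a = b ∧ ∀ t, t ≤ l ∨ r ≤ t → χ t = t := by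
  set α := (a - l)⁻¹ with hα
  set β := (r - a)⁻¹ with hβ
  have hα0 : 0 < α := inv_pos.2 (by linarith)
  have hβ0 : 0 < β := inv_pos.2 (by linarith)
  have hα1 : α * (a - l) = 1 := inv_mul_cancel₀ (by linarith)
  have hβ1 : β * (r - a) = 1 := inv_mul_cancel₀ (by linarith)
  -- A tent of height 1 at `a`, supported in `[l, r]`, with slopes `α` and `-β`. The map `t + (b -
  -- a) * g t` stays increasing precisely because `l < b < r`.
  let g : ℝ → ℝ := fun t => max 0 (min (α * (t - l)) (β * (r - t)))
  have hup : ∀ s t, s < t → g t ≤ g s + α * (t - s) := by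
    intro s t hst
    have h1 : 0 < α * (t - s) := mul_pos hα0 (by linarith)
    have h2 : 0 < β * (t - s) := mul_pos hβ0 (by linarith)
    refine max_le ?_ ?_
    · have : 0 ≤ g s := le_max_left _ _
      linarith
    · have h3 : min (α * (s - l)) (β * (r - s)) ≤ g s := le_max_right _ _
      have h4 : min (α * (t - l)) (β * (r - t)) - α * (t - s)
          ≤ min (α * (s - l)) (β * (r - s)) := by
        refine le_min ?_ ?_
        · have := min_le_left (α * (t - l)) (β * (r - t))
          linarith
        · have := min_le_right (α * (t - l)) (β * (r - t))
          linarith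
      linarith
  have hdown : ∀ s t, s < t → g s ≤ g t + β * (t - s) := by
    intro s t hst
    have h1 : 0 < α * (t - s) := mul_pos hα0 (by linarith)
    have h2 : 0 < β * (t - s) := mul_pos hβ0 (by linarith)
    refine max_le ?_ ?_
    · have : 0 ≤ g t := le_max_left _ _
      linarith
    · have h3 : min (α * (t - l)) (β * (r - t)) ≤ g t := le_max_right _ _
      have h4 : min (α * (s - l)) (β * (r - s)) - β * (t - s)
          ≤ min (α * (t - l)) (β * (r - t)) := by
        refine le_min ?_ ?_
        · have := min_le_left (α * (s - l)) (β * (r - s))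
          linarith
        · have := min_le_right (α * (s - l)) (β * (r - s))
          linarith
      linarith
  let f : ℝ → ℝ := fun t => t + (b - a) * g t
  have hmono : StrictMono f := by
    intro s t hst
    have hts : 0 < t - s := by linarith
    change s + (b - a) * g s < t + (b - a) * g t
    rcases le_total 0 (b - a) with hc | hc
    · have h1 := mul_le_mul_of_nonneg_left (hdown s t hst) hc
      have h2 : (b - a) * β < 1 := by nlinarith
      nlinarith [mul_lt_mul_of_pos_right h2 hts]
    · have h1 := mul_le_mul_of_nonpos_left (hup s t hst) hc
      have h2 : -(b - a) * α < 1 := by nlinarith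
      nlinarith [mul_lt_mul_of_pos_right h2 hts]
  have hout : ∀ t, t ≤ l ∨ r ≤ t → f t = t := by
    intro t ht
    have : g t = 0 := by
      refine max_eq_left ?_
      rcases ht with ht | ht
      · exact (min_le_left _ _).trans (mul_nonpos_of_nonneg_of_nonpos hα0.le (by linarith))
      · exact (min_le_right _ _).trans (mul_nonpos_of_nonneg_of_nonpos hβ0.le (by linarith))
    simp [f, this]
  have hcont : Continuous f := by fun_prop
  have hsurj : Function.Surjective f := by
    intro y
    have h1 : f (min y l) = min y l := hout _ (Or.inl (min_le_right _ _))
    have h2 : f (max y r) = max y r := hout _ (Or.inr (le_max_right _ _))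
    have := intermediate_value_Icc (f := f)
      (le_trans (min_le_left y l) (le_max_left y r)) hcont.continuousOn
    rw [h1, h2] at this
    obtain ⟨t, -, ht⟩ := this ⟨min_le_left y l, le_max_left y r⟩
    exact ⟨t, ht⟩
  refine ⟨hmono.orderIsoOfSurjective f hsurj, ?_, hout⟩
  change a + (b - a) * max 0 (min (α * (a - l)) (β * (r - a))) = b
  rw [hα1, hβ1]
  simp

lemma Finset.exists_gap {Z : Finset ℝ} {lo hi a : ℝ} (hlo : lo ∈ Z) (hhi : hi ∈ Z) (hloa : lo < a)
    (hahi : a < hi) (ha : a ∉ Z) :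
    ∃ l ∈ Z, ∃ r ∈ Z, l < a ∧ a < r ∧ ∀ z ∈ Z, z ≤ l ∨ r ≤ z := by
  obtain ⟨l, hl, hlmax⟩ := (Z.filter (· < a)).exists_maximal ⟨lo, by simp [hlo, hloa]⟩
  obtain ⟨r, hr, hrmin⟩ := (Z.filter (a < ·)).exists_minimal ⟨hi, by simp [hhi, hahi]⟩
  simp only [Finset.mem_filter] at hl hr hlmax hrmin
  refine ⟨l, hl.1, r, hr.1, hl.2, hr.2, fun z hz => ?_⟩
  rcases lt_trichotomy z a with h | h | h
  · left
    by_contra! h'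
    exact absurd (hlmax ⟨hz, h⟩ h'.le) (not_le.2 h')
  · exact absurd (h ▸ hz) ha
  · right
    by_contra! h'
    exact absurd (hrmin ⟨hz, h⟩ h'.le) (not_le.2 h')

/-- A continuous injective function with a zero inside an interval changes sign on it, in the
sense that its values at the end points have opposite signs. -/
lemma mul_neg_of_injOn {f : ℝ → ℝ} (hf : Continuous f) {l a r : ℝ} (hla : l < a) (har : a < r)
    (hinj : Set.InjOn f (Set.Icc l r)) (ha : f a = 0) : f l * f r < 0 := by
  have hlr : l ≤ r := (hla.trans har).le
  have hl : l ∈ Set.Icc l r := ⟨le_rfl, hlr⟩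
  have hr : r ∈ Set.Icc l r := ⟨hlr, le_rfl⟩
  have ham : a ∈ Set.Icc l r := ⟨hla.le, har.le⟩
  rcases hf.continuousOn.strictMonoOn_of_injOn_Icc' hlr hinj with h | h
  · have h1 := h hl ham hla
    have h2 := h ham hr har
    rw [ha] at h1 h2
    exact mul_neg_of_neg_of_pos h1 h2
  · have h1 := h hl ham hla
    have h2 := h ham hr har
    rw [ha] at h1 h2
    exact mul_neg_of_pos_of_neg h1 h2

lemma exists_zero_of_mul_neg {f : ℝ → ℝ} (hf : Continuous f) {l r : ℝ} (hlr : l < r)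
    (h : f l * f r < 0) : ∃ b, l < b ∧ b < r ∧ f b = 0 := by
  rcases mul_neg_iff.1 h with ⟨h1, h2⟩ | ⟨h1, h2⟩
  · obtain ⟨b, hb, hb0⟩ := intermediate_value_Ioo' hlr.le hf.continuousOn ⟨h2, h1⟩
    exact ⟨b, hb.1, hb.2, hb0⟩
  · obtain ⟨b, hb, hb0⟩ := intermediate_value_Ioo hlr.le hf.continuousOn ⟨h1, h2⟩
    exact ⟨b, hb.1, hb.2, hb0⟩

lemma sign_eq_of_ne_zero {f : ℝ → ℝ} (hf : Continuous f) {s t : ℝ}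
    (h : ∀ x ∈ Set.uIcc s t, f x ≠ 0) : SignType.sign (f s) = SignType.sign (f t) := by
  by_contra hne
  have hs := h s Set.left_mem_uIcc
  have ht := h t Set.right_mem_uIcc
  have : (0 : ℝ) ∈ Set.uIcc (f s) (f t) := by
    rcases lt_or_gt_of_ne hs with h1 | h1 <;> rcases lt_or_gt_of_ne ht with h2 | h2
    · simp [sign_neg h1, sign_neg h2] at hne
    · exact Set.mem_uIcc_of_le h1.le h2.le
    · exact Set.mem_uIcc_of_ge h2.le h1.le
    · simp [sign_pos h1, sign_pos h2] at hne
  obtain ⟨x, hx, hx0⟩ := intermediate_value_uIcc hf.continuousOn this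
  exact h x hx hx0

lemma mul_neg_iff_of_sign_eq {a b c d : ℝ} (h1 : SignType.sign a = SignType.sign c)
    (h2 : SignType.sign b = SignType.sign d) : a * b < 0 ↔ c * d < 0 := by
  rw [← sign_eq_neg_one_iff, ← sign_eq_neg_one_iff, sign_mul, sign_mul, h1, h2]

/-- If `f` and `g` have the same signs on `Z`, near infinity, and are injective between points
of `Z`, then their sign patterns agree up to an increasing bijection fixing `Z`. -/
lemma exists_orderIso_sign_eq (f : ℝ → ℝ) (hf : Continuous f) (lo hi : ℝ) (n : ℕ) :
    ∀ (g : ℝ → ℝ) (_ : Continuous g) (Z : Finset ℝ) (_ : lo ∈ Z) (_ : hi ∈ Z)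
      (_ : ∀ t, t ≤ lo ∨ hi ≤ t → f t ≠ 0 ∧ SignType.sign (f t) = SignType.sign (g t))
      (_ : ∀ z ∈ Z, SignType.sign (f z) = SignType.sign (g z))
      (_ : ∀ l r, l < r → (∀ z ∈ Z, z ≤ l ∨ r ≤ z) →
        Set.InjOn f (Set.Icc l r) ∧ Set.InjOn g (Set.Icc l r))
      (_ : {t | f t = 0 ∧ t ∉ Z}.Finite) (_ : {t | f t = 0 ∧ t ∉ Z}.ncard = n),
      ∃ χ : ℝ ≃o ℝ, (∀ z ∈ Z, χ z = z) ∧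
        ∀ t, SignType.sign (f t) = SignType.sign (g (χ t)) := by
  induction n with
  | zero =>
    intro g hg Z hlo hhi hout hZ hinj hfin hcard
    have hroot : ∀ t, f t = 0 → t ∈ Z := by
      intro t ht
      by_contra htZ
      rw [Set.ncard_eq_zero hfin] at hcard
      exact (Set.eq_empty_iff_forall_notMem.1 hcard t) ⟨ht, htZ⟩
    -- All zeros of `f` lie in `Z`, so the identity works: a zero of `g` inside a gap would give
    -- `g`, hence `f`, opposite signs at its ends.
    refine ⟨OrderIso.refl ℝ, fun z _ => rfl, fun t => ?_⟩
    change SignType.sign (f t) = SignType.sign (g t)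
    by_cases htZ : t ∈ Z
    · exact hZ t htZ
    by_cases ht : t ≤ lo ∨ hi ≤ t
    · exact (hout t ht).2
    push Not at ht
    obtain ⟨l, hl, r, hr, hlt, htr, hgap⟩ := Finset.exists_gap hlo hhi ht.1 ht.2 htZ
    have hlr := hlt.trans htr
    obtain ⟨hif, hig⟩ := hinj l r hlr hgap
    have hf0 : ∀ s, l < s → s < r → f s ≠ 0 := by
      intro s h1 h2 h3
      rcases hgap s (hroot s h3) with h | h <;> linarith
    have hg0 : ∀ s, l < s → s < r → g s ≠ 0 := by
      intro s h1 h2 h3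
      have h4 := (mul_neg_iff_of_sign_eq (hZ l hl) (hZ r hr)).2 (mul_neg_of_injOn hg h1 h2 hig h3)
      obtain ⟨b, hb1, hb2, hb3⟩ := exists_zero_of_mul_neg hf hlr h4
      exact hf0 b hb1 hb2 hb3
    -- By injectivity `f` is nonzero at one end of the gap, and `t` reaches that end without
    -- crossing a zero of `f` or `g`.
    by_cases hl0 : f l = 0
    · have hr0 : f r ≠ 0 := fun hr0 => hlr.ne
        (hif ⟨le_rfl, hlr.le⟩ ⟨hlr.le, le_rfl⟩ (hl0.trans hr0.symm))
      have hgr0 : g r ≠ 0 := by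
        have := hZ r hr
        rw [← sign_ne_zero, ← this, sign_ne_zero]; exact hr0
      rw [sign_eq_of_ne_zero hf (s := t) (t := r), sign_eq_of_ne_zero hg (s := t) (t := r), hZ r hr]
      all_goals
        intro x hx
        rw [Set.uIcc_of_le htr.le] at hx
        rcases hx.2.lt_or_eq with h | h
        · first | exact hf0 x (hlt.trans_le hx.1) h | exact hg0 x (hlt.trans_le hx.1) h
        · rw [h]; assumption
    · have hgl0 : g l ≠ 0 := by
        have := hZ l hl
        rw [← sign_ne_zero, ← this, sign_ne_zero]; exact hl0
      rw [sign_eq_of_ne_zero hf (s := t) (t := l), sign_eq_of_ne_zero hg (s := t) (t := l), hZ l hl]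
      all_goals
        intro x hx
        rw [Set.uIcc_of_ge hlt.le] at hx
        rcases hx.1.lt_or_eq with h | h
        · first | exact hf0 x h (hx.2.trans_lt htr) | exact hg0 x h (hx.2.trans_lt htr)
        · rw [← h]; assumption
  | succ n ih =>
    intro g hg Z hlo hhi hout hZ hinj hfin hcard
    obtain ⟨a, ha0, haZ⟩ : {t | f t = 0 ∧ t ∉ Z}.Nonempty := by
      rw [← Set.ncard_pos hfin]; omega
    have ha : lo < a ∧ a < hi := by
      by_contra h
      exact (hout a (by by_contra! h'; exact h h')).1 ha0
    obtain ⟨l, hl, r, hr, hla, har, hgap⟩ := Finset.exists_gap hlo hhi ha.1 ha.2 haZ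
    have hlr := hla.trans har
    obtain ⟨hif, -⟩ := hinj l r hlr hgap
    obtain ⟨b, hlb, hbr, hb0⟩ := exists_zero_of_mul_neg hg hlr
      ((mul_neg_iff_of_sign_eq (hZ l hl) (hZ r hr)).1 (mul_neg_of_injOn hf hla har hif ha0))
    obtain ⟨χ₁, hχa, hχout⟩ := exists_orderIso_apply_eq hla har hlb hbr
    have hχZ : ∀ z ∈ Z, χ₁ z = z := fun z hz => hχout z (hgap z hz)
    have hlol : lo ≤ l := by
      rcases hgap lo hlo with h | h
      · exact h
      · linarith [ha.1]
    have hrhi : r ≤ hi := by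
      rcases hgap hi hhi with h | h
      · linarith [ha.2]
      · exact h
    have hset : {t | f t = 0 ∧ t ∉ insert a Z} = {t | f t = 0 ∧ t ∉ Z} \ {a} := by
      ext t
      simp only [Finset.mem_insert, Set.mem_ofPred_eq, Set.mem_sdiff, Set.mem_singleton_iff]
      tauto
    -- Once the zero `b` of `g` is pulled back to `a`, the point `a` can join `Z`. Since `χ₁` fixes
    -- `Z`, it sends gaps to gaps, so injectivity survives.
    obtain ⟨χ₂, hχ₂, hsign⟩ := ih (g ∘ χ₁) (hg.comp χ₁.continuous) (insert a Z)
      (Finset.mem_insert_of_mem hlo) (Finset.mem_insert_of_mem hhi)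
      (by
        intro t ht
        have : χ₁ t = t := hχout t (ht.imp (·.trans hlol) (hrhi.trans ·))
        simpa [this] using hout t ht)
      (by
        intro z hz
        rcases Finset.mem_insert.1 hz with rfl | hz
        · simp [hχa, ha0, hb0]
        · simpa [hχZ z hz] using hZ z hz)
      (by
        intro l' r' hlr' hgap'
        refine ⟨(hinj l' r' hlr' fun z hz => hgap' z (Finset.mem_insert_of_mem hz)).1, ?_⟩
        have h2 := (hinj (χ₁ l') (χ₁ r') (χ₁.strictMono hlr') (by
          intro z hz
          rw [← hχZ z hz, χ₁.le_iff_le, χ₁.le_iff_le]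
          exact hgap' z (Finset.mem_insert_of_mem hz))).2
        refine h2.comp χ₁.injective.injOn ?_
        intro x hx
        exact ⟨χ₁.monotone hx.1, χ₁.monotone hx.2⟩)
      (by rw [hset]; exact hfin.sdiff)
      (by
        rw [hset, Set.ncard_sdiff_singleton_of_mem (show a ∈ {t | f t = 0 ∧ t ∉ Z} from ⟨ha0, haZ⟩),
          hcard]
        rfl)
    refine ⟨χ₂.trans χ₁, fun z hz => ?_, hsign⟩
    simp [hχ₂ z (Finset.mem_insert_of_mem hz), hχZ z hz]

/-! ### Pseudo-division and signs of one-variable real polynomials -/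

/-- Each cancellation of leading terms costs a factor `q.leadingCoeff` instead of a division, so the
identity survives every specialization of `A`. -/
lemma exists_pseudo_remainder {A : Type*} [CommRing A] (q : A[X]) (hq : 0 < q.natDegree) (n : ℕ) :
    ∀ p : A[X], p.natDegree ≤ n → ∃ (k : ℕ) (s r : A[X]), r.degree < q.degree ∧
      C q.leadingCoeff ^ k * p = q * s + r := by
  induction n using Nat.strong_induction_on with
  | _ n ih =>
    intro p hp
    rcases lt_or_ge p.natDegree q.natDegree with h | h
    · exact ⟨0, 0, p, degree_lt_degree h, by simp⟩
    · have h1 := natDegree_cancelLeads_lt_of_natDegree_le_natDegree h (hq.trans_le h)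
      obtain ⟨k, s, r, hr, he⟩ := ih _ (h1.trans_le hp) (q.cancelLeads p) le_rfl
      refine ⟨k + 1, s + C q.leadingCoeff ^ k * (C p.leadingCoeff * X ^ (p.natDegree - q.natDegree)),
        r, hr, ?_⟩
      rw [cancelLeads, Nat.sub_eq_zero_of_le h] at he
      linear_combination he

lemma exists_sub_remainder {A : Type*} [CommRing A] (p q : A[X]) (hp : p ≠ 0)
    (hqp : q.degree ≤ p.degree) : ∃ r : A[X], r.degree < p.degree ∧ (0 < q.natDegree →
      ∃ (k : ℕ) (s : A[X]), C q.leadingCoeff ^ k * p = q * s + r) := by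
  by_cases hq : 0 < q.natDegree
  · obtain ⟨k, s, r, hr, he⟩ := exists_pseudo_remainder q hq p.natDegree p le_rfl
    exact ⟨r, hr.trans_le hqp, fun _ => ⟨k, s, he⟩⟩
  · exact ⟨0, by simpa [bot_lt_iff_ne_bot] using hp, fun h => absurd h hq⟩

lemma eventually_sign_eval_atTop (p : ℝ[X]) (hp : 0 < p.natDegree) :
    ∀ᶠ t in Filter.atTop, SignType.sign (p.eval t) = SignType.sign p.leadingCoeff := by
  have hd : 0 < p.degree := natDegree_pos_iff_degree_pos.1 hp
  have h0 : p.leadingCoeff ≠ 0 := leadingCoeff_ne_zero.2 (ne_zero_of_natDegree_gt hp)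
  rcases lt_or_gt_of_ne h0 with h | h
  · filter_upwards [(tendsto_atBot_of_leadingCoeff_nonpos p hd h.le).eventually_lt_atBot 0] with t ht
    rw [sign_neg ht, sign_neg h]
  · filter_upwards [(tendsto_atTop_of_leadingCoeff_nonneg p hd h.le).eventually_gt_atTop 0] with t ht
    rw [sign_pos ht, sign_pos h]

lemma eventually_sign_eval_atBot (p : ℝ[X]) (hp : 0 < p.natDegree) :
    ∀ᶠ t in Filter.atBot, SignType.sign (p.eval t) =
      SignType.sign ((-1) ^ p.natDegree * p.leadingCoeff) := by
  have h := eventually_sign_eval_atTop (p.comp (-X)) (by simpa [natDegree_comp] using hp)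
  have h' := Filter.tendsto_neg_atBot_atTop.eventually h
  filter_upwards [h'] with t ht
  simpa [comp_neg_X_leadingCoeff_eq] using ht

lemma injOn_eval_of_derivative_ne_zero (p : ℝ[X]) {l r : ℝ}
    (h : ∀ x, l < x → x < r → p.derivative.eval x ≠ 0) :
    Set.InjOn (fun t => p.eval t) (Set.Icc l r) := by
  have key : ∀ x ∈ Set.Icc l r, ∀ y ∈ Set.Icc l r, x < y → p.eval x ≠ p.eval y := by
    intro x hx y hy hxy he
    obtain ⟨c, hc, hc0⟩ := exists_deriv_eq_zero hxy (f := fun t => p.eval t) p.continuousOn he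
    rw [Polynomial.deriv] at hc0
    exact h c (hx.1.trans_lt hc.1) (hc.2.trans_le hy.2) hc0
  intro x hx y hy he
  rcases lt_trichotomy x y with h | h | h
  · exact absurd he (key x hx y hy h)
  · exact h
  · exact absurd he.symm (key y hy x hx h)

/-- An increasing bijection fixing the zeros cannot carry a point across one. This lets one
polynomial be adjusted without disturbing the others. -/
lemma sign_eq_of_fix_zeros {f : ℝ → ℝ} (hf : Continuous f) (χ : ℝ ≃o ℝ)
    (h : ∀ z, f z = 0 → χ z = z) (t : ℝ) : SignType.sign (f t) = SignType.sign (f (χ t)) := by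
  by_cases ht : f t = 0
  · rw [h t ht]
  · refine sign_eq_of_ne_zero hf fun x hx hx0 => ?_
    have hfix := h x hx0
    have hxt : x = t := by
      rcases le_total t (χ t) with hle | hle
      · rw [Set.uIcc_of_le hle] at hx
        exact le_antisymm (χ.le_iff_le.1 (hfix.trans_le hx.2)) hx.1
      · rw [Set.uIcc_of_ge hle] at hx
        exact le_antisymm hx.2 (χ.le_iff_le.1 (hx.1.trans_eq hfix.symm))
    exact ht (hxt ▸ hx0)

/-- `Z` contains the critical points of `p`, so by Rolle `p` and `q ∘ φ` are injective on its gaps.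
Degree and leading sign settle the behaviour near infinity; adding two far points to `Z` reduces to
`exists_orderIso_sign_eq`. -/
lemma exists_orderIso_sign_eval_eq (p q : ℝ[X]) (hp : 0 < p.natDegree)
    (hdeg : p.natDegree = q.natDegree)
    (hlc : SignType.sign p.leadingCoeff = SignType.sign q.leadingCoeff) (φ : ℝ ≃o ℝ)
    (hder : ∀ t, SignType.sign (p.derivative.eval t) = SignType.sign (q.derivative.eval (φ t)))
    (Z : Finset ℝ) (hZ : ∀ z ∈ Z, SignType.sign (p.eval z) = SignType.sign (q.eval (φ z)))
    (hroot : ∀ z, p.derivative.eval z = 0 → z ∈ Z) :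
    ∃ χ : ℝ ≃o ℝ, (∀ z ∈ Z, χ z = z) ∧
      ∀ t, SignType.sign (p.eval t) = SignType.sign (q.eval (φ (χ t))) := by
  have hp0 : p ≠ 0 := ne_zero_of_natDegree_gt hp
  have hlc0 : p.leadingCoeff ≠ 0 := leadingCoeff_ne_zero.2 hp0
  have htop : ∀ᶠ t in Filter.atTop, p.eval t ≠ 0 ∧
      SignType.sign (p.eval t) = SignType.sign (q.eval (φ t)) := by
    filter_upwards [eventually_sign_eval_atTop p hp,
      φ.tendsto_atTop.eventually (eventually_sign_eval_atTop q (hdeg ▸ hp))] with t h1 h2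
    rw [← sign_ne_zero, h1, h2, sign_ne_zero]
    exact ⟨hlc0, hlc⟩
  have hbot : ∀ᶠ t in Filter.atBot, p.eval t ≠ 0 ∧
      SignType.sign (p.eval t) = SignType.sign (q.eval (φ t)) := by
    filter_upwards [eventually_sign_eval_atBot p hp,
      φ.tendsto_atBot.eventually (eventually_sign_eval_atBot q (hdeg ▸ hp))] with t h1 h2
    rw [← sign_ne_zero, h1, h2, sign_ne_zero, ← hdeg, sign_mul, sign_mul, hlc]
    exact ⟨mul_ne_zero (pow_ne_zero _ (by norm_num)) hlc0, rfl⟩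
  obtain ⟨hi, hhi⟩ := Filter.eventually_atTop.1 htop
  obtain ⟨lo, hlo⟩ := Filter.eventually_atBot.1 hbot
  have hout : ∀ t, t ≤ lo ∨ hi ≤ t → p.eval t ≠ 0 ∧
      SignType.sign (p.eval t) = SignType.sign (q.eval (φ t)) :=
    fun t ht => ht.elim (hlo t) (hhi t)
  have hfin : {t | p.eval t = 0 ∧ t ∉ insert lo (insert hi Z)}.Finite := by
    refine p.roots.toFinset.finite_toSet.subset fun t ht => ?_
    simpa [hp0] using ht.1
  obtain ⟨χ, hχ, hs⟩ := exists_orderIso_sign_eq (fun t => p.eval t) p.continuous lo hi _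
    (fun t => q.eval (φ t)) (q.continuous.comp φ.continuous) (insert lo (insert hi Z))
    (by simp) (by simp) hout
    (by
      intro z hz
      simp only [Finset.mem_insert] at hz
      rcases hz with rfl | rfl | hz
      · exact (hout _ (Or.inl le_rfl)).2
      · exact (hout _ (Or.inr le_rfl)).2
      · exact hZ z hz)
    (by
      intro l r hlr hgap
      have hne : ∀ x, l < x → x < r → p.derivative.eval x ≠ 0 := by
        intro x h1 h2 h3
        rcases hgap x (by simp [hroot x h3]) with h | h <;> linarith
      refine ⟨injOn_eval_of_derivative_ne_zero p hne, ?_⟩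
      have hq : Set.InjOn (fun t => q.eval t) (Set.Icc (φ l) (φ r)) := by
        refine injOn_eval_of_derivative_ne_zero q fun x h1 h2 => ?_
        obtain ⟨y, rfl⟩ := φ.surjective x
        rw [← sign_ne_zero, ← hder y, sign_ne_zero]
        exact hne y (φ.lt_iff_lt.1 h1) (φ.lt_iff_lt.1 h2)
      exact hq.comp φ.injective.injOn fun x hx => ⟨φ.monotone hx.1, φ.monotone hx.2⟩)
    hfin rfl
  exact ⟨χ, fun z hz => hχ z (by simp [hz]), hs⟩

/-! ### Sign-determined families -/

/-- A family of polynomials with coefficients in `A` is sign-determined by a finite subset `S` of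
`A` if any two real specializations with the same signs on `S` yield, up to an increasing bijection
of the line, the same sign patterns. -/
def SignDetermined {A : Type*} [CommRing A] (F : Multiset A[X]) (S : Finset A) : Prop :=
  ∀ u v : A →+* ℝ, (∀ a ∈ S, SignType.sign (u a) = SignType.sign (v a)) →
    ∃ φ : ℝ ≃o ℝ, ∀ p ∈ F, ∀ t,
      SignType.sign ((p.map u).eval t) = SignType.sign ((p.map v).eval (φ t))

lemma map_eraseLead_of_leadingCoeff_eq_zero {A : Type*} [CommRing A] (p : A[X]) (u : A →+* ℝ)
    (h : u p.leadingCoeff = 0) : p.eraseLead.map u = p.map u := by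
  conv_rhs => rw [← eraseLead_add_C_mul_X_pow p]
  rw [Polynomial.map_add, Polynomial.map_mul, map_C, h, C_0, zero_mul, add_zero]

/-- At a zero of `q`, the sign of `p` is that of its remainder up to a power of the nonzero leading
coefficient of `q`. So `φ` already matches `p` at the zeros of its derivative and of `G`, and the
correction between them fixes those zeros. -/
lemma exists_orderIso_of_remainders {A : Type*} [CommRing A] [IsAddTorsionFree A] (p : A[X])
    (hp : 0 < p.natDegree) (G : Multiset A[X]) (rem : A[X] → A[X])
    (hrem : ∀ q ∈ derivative p ::ₘ G, 0 < q.natDegree →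
      ∃ (k : ℕ) (s : A[X]), C q.leadingCoeff ^ k * p = q * s + rem q)
    (u v : A →+* ℝ) (hu : ∀ q ∈ p ::ₘ G, u q.leadingCoeff ≠ 0)
    (huv : ∀ q ∈ p ::ₘ G, SignType.sign (u q.leadingCoeff) = SignType.sign (v q.leadingCoeff))
    (φ : ℝ ≃o ℝ)
    (hφ : ∀ q ∈ (derivative p ::ₘ G) + (derivative p ::ₘ G).map rem, ∀ t,
      SignType.sign ((q.map u).eval t) = SignType.sign ((q.map v).eval (φ t))) :
    ∃ ψ : ℝ ≃o ℝ, ∀ q ∈ p ::ₘ G, ∀ t,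
      SignType.sign ((q.map u).eval t) = SignType.sign ((q.map v).eval (ψ t)) := by
  classical
  have hG : ∀ q ∈ derivative p ::ₘ G, u q.leadingCoeff ≠ 0 ∧
      SignType.sign (u q.leadingCoeff) = SignType.sign (v q.leadingCoeff) := by
    intro q hq
    rcases Multiset.mem_cons.1 hq with rfl | hq
    · have h1 := hu p (Multiset.mem_cons_self _ _)
      have h2 := huv p (Multiset.mem_cons_self _ _)
      rw [leadingCoeff_derivative, map_mul u, map_mul v, map_natCast, map_natCast, sign_mul, sign_mul,
        h2]
      exact ⟨mul_ne_zero h1 (by exact_mod_cast hp.ne'), rfl⟩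
    · exact ⟨hu q (Multiset.mem_cons_of_mem hq), huv q (Multiset.mem_cons_of_mem hq)⟩
  have hG0 : ∀ q ∈ derivative p ::ₘ G, q.map u ≠ 0 := by
    intro q hq h0
    have := leadingCoeff_map_of_leadingCoeff_ne_zero u (hG q hq).1
    rw [h0, leadingCoeff_zero] at this
    exact (hG q hq).1 this.symm
  let Z : Finset ℝ := (derivative p ::ₘ G).toFinset.biUnion fun q => (q.map u).roots.toFinset
  have hmemZ : ∀ z, z ∈ Z ↔ ∃ q ∈ derivative p ::ₘ G, (q.map u).eval z = 0 := by
    intro z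
    simp only [Z, Finset.mem_biUnion, Multiset.mem_toFinset]
    refine exists_congr fun q => and_congr_right fun hq => ?_
    rw [mem_roots (hG0 q hq), IsRoot]
  have hup := hu p (Multiset.mem_cons_self _ _)
  have huvp := huv p (Multiset.mem_cons_self _ _)
  have hvp : v p.leadingCoeff ≠ 0 := by rwa [← sign_ne_zero, ← huvp, sign_ne_zero]
  obtain ⟨χ, hχ, hs⟩ := exists_orderIso_sign_eval_eq (p.map u) (p.map v)
    (by rwa [natDegree_map_of_leadingCoeff_ne_zero u hup])
    (by rw [natDegree_map_of_leadingCoeff_ne_zero u hup,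
      natDegree_map_of_leadingCoeff_ne_zero v hvp])
    (by rwa [leadingCoeff_map_of_leadingCoeff_ne_zero u hup,
      leadingCoeff_map_of_leadingCoeff_ne_zero v hvp]) φ
    (by
      intro t
      rw [derivative_map, derivative_map]
      exact hφ _ (by simp) t) Z
    (by
      intro z hz
      obtain ⟨q, hq, hz0⟩ := (hmemZ z).1 hz
      obtain ⟨hq1, hq2⟩ := hG q hq
      have hqv : v q.leadingCoeff ≠ 0 := by rwa [← sign_ne_zero, ← hq2, sign_ne_zero]
      have hz1 : (q.map v).eval (φ z) = 0 := by
        rw [← sign_eq_zero_iff, ← hφ q (Multiset.mem_add.2 (Or.inl hq)) z, hz0, sign_zero]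
      have hdeg : 0 < q.natDegree := by
        by_contra h
        obtain ⟨a, rfl⟩ := natDegree_eq_zero.1 (Nat.eq_zero_of_not_pos h)
        simp only [map_C, eval_C, leadingCoeff_C] at hz0 hq1
        exact hq1 hz0
      obtain ⟨k, s, he⟩ := hrem q hq hdeg
      have h1 : u q.leadingCoeff ^ k * (p.map u).eval z = ((rem q).map u).eval z := by
        simpa [hz0] using congrArg (fun f : A[X] => (f.map u).eval z) he
      have h2 : v q.leadingCoeff ^ k * (p.map v).eval (φ z) = ((rem q).map v).eval (φ z) := by
        simpa [hz1] using congrArg (fun f : A[X] => (f.map v).eval (φ z)) he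
      have h3 := hφ (rem q) (Multiset.mem_add.2 (Or.inr (Multiset.mem_map_of_mem rem hq))) z
      rw [← h1, ← h2, sign_mul, sign_mul, sign_pow, sign_pow, hq2] at h3
      exact mul_left_cancel₀ (pow_ne_zero k (sign_ne_zero.2 hqv)) h3)
    (by
      intro z hz
      rw [derivative_map] at hz
      exact (hmemZ z).2 ⟨_, Multiset.mem_cons_self _ _, hz⟩)
  refine ⟨χ.trans φ, fun q hq t => ?_⟩
  rcases Multiset.mem_cons.1 hq with rfl | hq
  · exact hs t
  · have hq' : q ∈ derivative p ::ₘ G := Multiset.mem_cons_of_mem hq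
    rw [sign_eq_of_fix_zeros (q.map u).continuous χ
      (fun z hz => hχ z ((hmemZ z).2 ⟨q, hq', hz⟩)) t]
    exact hφ q (Multiset.mem_add.2 (Or.inl hq')) (χ t)

/-- Induction on the multiset of degrees in the Dershowitz–Manna order, where one entry may be
replaced by any number of smaller ones. If a leading coefficient specializes to zero, its term is
erased; otherwise a `p` of maximal degree is traded for its derivative and remainders. -/
lemma exists_signDetermined {A : Type*} [CommRing A] [IsAddTorsionFree A] (F : Multiset A[X]) :
    ∃ S : Finset A, SignDetermined F S := by
  classical
  have wf := InvImage.wf (fun F : Multiset A[X] => F.map degree)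
    (Multiset.wellFounded_isDershowitzMannaLT (α := WithBot ℕ))
  induction F using wf.induction with
  | _ F ih =>
  have ih' : ∀ (G N : Multiset A[X]) (p : A[X]), F = p ::ₘ G → (∀ q ∈ N, q.degree < p.degree) →
      ∃ S : Finset A, SignDetermined (G + N) S := by
    intro G N p hF hN
    refine ih (G + N) ⟨G.map degree, N.map degree, {p.degree}, by simp, by simp, ?_, ?_⟩
    · simp [hF, ← Multiset.singleton_add, add_comm]
    · intro y hy
      obtain ⟨q, hq, rfl⟩ := Multiset.mem_map.1 hy
      exact ⟨p.degree, by simp, hN q hq⟩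
  rcases eq_or_ne F 0 with rfl | hF0
  · exact ⟨∅, fun u v _ => ⟨OrderIso.refl ℝ, by simp⟩⟩
  obtain ⟨p, hpF, hmax⟩ := F.toFinset.exists_max_image degree
    (by simpa [Finset.nonempty_iff_ne_empty] using hF0)
  rw [Multiset.mem_toFinset] at hpF
  obtain ⟨G, hG⟩ := Multiset.exists_cons_of_mem hpF
  by_cases hp : 0 < p.natDegree
  swap
  · obtain ⟨S, hS⟩ := ih' G 0 p hG (by simp)
    obtain ⟨a, ha⟩ := natDegree_eq_zero.1 (Nat.eq_zero_of_not_pos hp)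
    refine ⟨insert a S, fun u v huv => ?_⟩
    obtain ⟨φ, hφ⟩ := hS u v fun b hb => huv b (Finset.mem_insert_of_mem hb)
    refine ⟨φ, fun q hq t => ?_⟩
    rw [hG, Multiset.mem_cons] at hq
    rcases hq with rfl | hq
    · simpa [← ha] using huv a (Finset.mem_insert_self _ _)
    · exact hφ q (by simpa using hq) t
  have hp0 : p ≠ 0 := ne_zero_of_natDegree_gt hp
  have hmaxG : ∀ q ∈ derivative p ::ₘ G, q.degree ≤ p.degree := by
    intro q hq
    rcases Multiset.mem_cons.1 hq with rfl | hq
    · exact (degree_derivative_lt hp0).le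
    · exact hmax q (by simp [hG, hq])
  have hex : ∀ q : A[X], ∃ r : A[X], q ∈ derivative p ::ₘ G → r.degree < p.degree ∧
      (0 < q.natDegree → ∃ (k : ℕ) (s : A[X]), C q.leadingCoeff ^ k * p = q * s + r) := by
    intro q
    by_cases hq : q ∈ derivative p ::ₘ G
    · obtain ⟨r, hr⟩ := exists_sub_remainder p q hp0 (hmaxG q hq)
      exact ⟨r, fun _ => hr⟩
    · exact ⟨0, fun h => absurd h hq⟩
  choose rem hrem using hex
  obtain ⟨S₀, hS₀⟩ := ih' G (derivative p ::ₘ (derivative p ::ₘ G).map rem) p hG (by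
    intro q hq
    rcases Multiset.mem_cons.1 hq with rfl | hq
    · exact degree_derivative_lt hp0
    · obtain ⟨q', hq', rfl⟩ := Multiset.mem_map.1 hq
      exact (hrem q' hq').1)
  have herase : ∀ q : A[X], ∃ S : Finset A, q ∈ F → q ≠ 0 →
      SignDetermined (F.erase q + {q.eraseLead}) S := by
    intro q
    by_cases hq : q ∈ F ∧ q ≠ 0
    · obtain ⟨S, hS⟩ := ih' (F.erase q) {q.eraseLead} q (Multiset.cons_erase hq.1).symm
        (by simpa using degree_eraseLead_lt hq.2)
      exact ⟨S, fun _ _ => hS⟩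
    · exact ⟨∅, fun h1 h2 => absurd ⟨h1, h2⟩ hq⟩
  choose T hT using herase
  -- The zero polynomial is dropped separately: erasing its leading term would not lower the degree.
  by_cases h0F : (0 : A[X]) ∈ F
  · obtain ⟨S, hS⟩ := ih' (F.erase 0) 0 0 (Multiset.cons_erase h0F).symm (by simp)
    refine ⟨S, fun u v huv => ?_⟩
    obtain ⟨φ, hφ⟩ := hS u v huv
    refine ⟨φ, fun q hq t => ?_⟩
    by_cases hq0 : q = 0
    · simp [hq0]
    · exact hφ q (by simpa using (Multiset.mem_erase_of_ne hq0).2 hq) t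
  refine ⟨S₀ ∪ F.toFinset.image leadingCoeff ∪ F.toFinset.biUnion T, fun u v huv => ?_⟩
  have hlc : ∀ q ∈ F, SignType.sign (u q.leadingCoeff) = SignType.sign (v q.leadingCoeff) := by
    intro q hq
    refine huv _ (Finset.mem_union_left _ (Finset.mem_union_right _ ?_))
    exact Finset.mem_image_of_mem _ (Multiset.mem_toFinset.2 hq)
  by_cases hall : ∀ q ∈ F, u q.leadingCoeff ≠ 0
  · obtain ⟨φ, hφ⟩ := hS₀ u v fun a ha =>
      huv a (Finset.mem_union_left _ (Finset.mem_union_left _ ha))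
    rw [hG] at hall hlc ⊢
    refine exists_orderIso_of_remainders p hp G rem (fun q hq => (hrem q hq).2) u v hall hlc φ ?_
    intro q hq
    refine hφ q ?_
    simp only [Multiset.mem_add, Multiset.mem_cons] at hq ⊢
    tauto
  · push Not at hall
    obtain ⟨q, hq, hq0⟩ := hall
    have hq0' : v q.leadingCoeff = 0 := by
      rw [← sign_eq_zero_iff, ← hlc q hq, hq0, sign_zero]
    obtain ⟨φ, hφ⟩ := hT q hq (fun h => h0F (h ▸ hq)) u v fun a ha =>
      huv a (Finset.mem_union_right _ (Finset.mem_biUnion.2 ⟨q, by simpa using hq, ha⟩))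
    refine ⟨φ, fun q' hq' t => ?_⟩
    by_cases hqq : q' = q
    · subst hqq
      have := hφ q'.eraseLead (by simp) t
      rwa [map_eraseLead_of_leadingCoeff_eq_zero _ _ hq0,
        map_eraseLead_of_leadingCoeff_eq_zero _ _ hq0'] at this
    · exact hφ q' (Multiset.mem_add.2 (Or.inl ((Multiset.mem_erase_of_ne hqq).2 hq'))) t

/-! ### Semi-algebraic sets through sign conditions -/

variable {σ τ : Type}

/-- `S` is the union of the sign cells of `F` that it meets, of which there are finitely many. In
each cell the equations merge into one sum of squares. With the converse `exists_signs`, Boolean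
closure is immediate. -/
lemma isSemialgebraic_of_signs {S : Set (σ → ℝ)} (F : Finset (MvPolynomial σ ℝ))
    (hF : ∀ x y, (∀ p ∈ F, SignType.sign (MvPolynomial.eval x p) =
      SignType.sign (MvPolynomial.eval y p)) → x ∈ S → y ∈ S) : IsSemialgebraic S := by
  classical
  let cell : (F → SignType) → Set (σ → ℝ) :=
    fun s => {y | ∀ p : F, SignType.sign (MvPolynomial.eval y p.1) = s p}
  let I := {s : F → SignType // ∃ x ∈ S, x ∈ cell s}
  have hcell : ∀ s, IsBasicSemialgebraic (cell s) := by
    intro s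
    let J := {p : F // s p ≠ 0}
    let e : Fin (Fintype.card J) ≃ J := (Fintype.equivFin J).symm
    refine ⟨Fintype.card J, ∑ p : F, if s p = 0 then p.1 ^ 2 else 0,
      fun j => MvPolynomial.C (s (e j).1 : ℝ) * (e j).1.1, ?_⟩
    ext y
    have hsum : MvPolynomial.eval y (∑ p : F, if s p = 0 then p.1 ^ 2 else 0) = 0 ↔
        ∀ p : F, s p = 0 → MvPolynomial.eval y p.1 = 0 := by
      rw [map_sum, Finset.sum_eq_zero_iff_of_nonneg]
      · refine ⟨fun h p hp => ?_, fun h p _ => ?_⟩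
        · simpa [hp] using h p (Finset.mem_univ _)
        · by_cases hp : s p = 0
          · simp [hp, h p hp]
          · simp [hp]
      · intro p _
        by_cases hp : s p = 0
        · simpa [hp] using sq_nonneg _
        · simp [hp]
    have hpos : ∀ (c : SignType) (r : ℝ), c ≠ 0 → (0 < (c : ℝ) * r ↔ SignType.sign r = c) := by
      intro c r hc
      cases c
      · exact absurd rfl hc
      · simpa using sign_eq_neg_one_iff.symm
      · simpa using sign_eq_one_iff.symm
    simp only [cell, Set.mem_ofPred_eq, hsum]
    constructor
    · intro h
      refine ⟨fun p hp => by rw [← sign_eq_zero_iff, h p, hp], fun j => ?_⟩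
      simpa using (hpos _ _ (e j).2).2 (h (e j).1)
    · rintro ⟨h0, h1⟩ p
      by_cases hp : s p = 0
      · rw [h0 p hp, hp, sign_zero]
      · have := h1 (e.symm ⟨p, hp⟩)
        simp only [Equiv.apply_symm_apply, map_mul, MvPolynomial.eval_C] at this
        exact (hpos _ _ hp).1 this
  let e : Fin (Fintype.card I) ≃ I := (Fintype.equivFin I).symm
  refine ⟨Fintype.card I, fun i => cell (e i).1, fun i => hcell _, ?_⟩
  ext y
  rw [Set.mem_iUnion]
  constructor
  · intro hy
    let s : I := ⟨fun p => SignType.sign (MvPolynomial.eval y p.1), y, hy, fun _ => rfl⟩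
    refine ⟨e.symm s, ?_⟩
    rw [Equiv.apply_symm_apply]
    exact fun _ => rfl
  · rintro ⟨i, hi⟩
    obtain ⟨x, hxS, hx⟩ := (e i).2
    exact hF x y (fun p hp => (hx ⟨p, hp⟩).trans (hi ⟨p, hp⟩).symm) hxS

lemma IsSemialgebraic.exists_signs {S : Set (σ → ℝ)} (hS : IsSemialgebraic S) :
    ∃ F : Finset (MvPolynomial σ ℝ), ∀ x y, (∀ p ∈ F, SignType.sign (MvPolynomial.eval x p) =
      SignType.sign (MvPolynomial.eval y p)) → (x ∈ S ↔ y ∈ S) := by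
  classical
  obtain ⟨N, B, hB, rfl⟩ := hS
  choose k P Q hPQ using hB
  refine ⟨Finset.univ.image P ∪ Finset.univ.biUnion fun i => Finset.univ.image (Q i),
    fun x y h => ?_⟩
  have hP : ∀ i, SignType.sign (MvPolynomial.eval x (P i)) =
      SignType.sign (MvPolynomial.eval y (P i)) := fun i => h _ (by simp)
  have hQ : ∀ i j, SignType.sign (MvPolynomial.eval x (Q i j)) =
      SignType.sign (MvPolynomial.eval y (Q i j)) := fun i j =>
    h _ (Finset.mem_union_right _ (Finset.mem_biUnion.2 ⟨i, by simp, by simp⟩))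
  simp only [Set.mem_iUnion, hPQ, Set.mem_ofPred_eq]
  refine exists_congr fun i => and_congr ?_ (forall_congr' fun j => ?_)
  · rw [← sign_eq_zero_iff, hP i, sign_eq_zero_iff]
  · rw [← sign_eq_one_iff, hQ i j, sign_eq_one_iff]

lemma IsSemialgebraic.compl {S : Set (σ → ℝ)} (hS : IsSemialgebraic S) : IsSemialgebraic Sᶜ := by
  obtain ⟨F, hF⟩ := hS.exists_signs
  exact isSemialgebraic_of_signs F fun x y h => (not_congr (hF x y h)).1

lemma IsSemialgebraic.inter {S T : Set (σ → ℝ)} (hS : IsSemialgebraic S)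
    (hT : IsSemialgebraic T) : IsSemialgebraic (S ∩ T) := by
  classical
  obtain ⟨F, hF⟩ := hS.exists_signs
  obtain ⟨G, hG⟩ := hT.exists_signs
  refine isSemialgebraic_of_signs (F ∪ G) fun x y h => ?_
  exact And.imp (hF x y fun p hp => h p (Finset.mem_union_left _ hp)).1
    (hG x y fun p hp => h p (Finset.mem_union_right _ hp)).1

lemma IsSemialgebraic.union {S T : Set (σ → ℝ)} (hS : IsSemialgebraic S)
    (hT : IsSemialgebraic T) : IsSemialgebraic (S ∪ T) := by
  simpa [Set.compl_inter] using (hS.compl.inter hT.compl).compl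

lemma isSemialgebraic_univ : IsSemialgebraic (Set.univ : Set (σ → ℝ)) :=
  isSemialgebraic_of_signs ∅ fun _ _ _ => id

lemma isSemialgebraic_empty : IsSemialgebraic (∅ : Set (σ → ℝ)) :=
  isSemialgebraic_of_signs ∅ fun _ _ _ => id

lemma isSemialgebraic_pos (p : MvPolynomial σ ℝ) :
    IsSemialgebraic {x | 0 < MvPolynomial.eval x p} := by
  refine isSemialgebraic_of_signs {p} fun x y h hx => ?_
  rw [Set.mem_ofPred_eq, ← sign_eq_one_iff] at hx ⊢
  rw [← hx, h p (by simp)]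

lemma isSemialgebraic_lt (p q : MvPolynomial σ ℝ) :
    IsSemialgebraic {x | MvPolynomial.eval x p < MvPolynomial.eval x q} := by
  simpa using isSemialgebraic_pos (q - p)

lemma isSemialgebraic_le (p q : MvPolynomial σ ℝ) :
    IsSemialgebraic {x | MvPolynomial.eval x p ≤ MvPolynomial.eval x q} := by
  simpa [Set.compl_ofPred] using (isSemialgebraic_lt q p).compl

lemma isSemialgebraic_iInter {ι : Type} [Finite ι] {S : ι → Set (σ → ℝ)}
    (hS : ∀ i, IsSemialgebraic (S i)) : IsSemialgebraic (⋂ i, S i) := by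
  classical
  cases nonempty_fintype ι
  choose F hF using fun i => (hS i).exists_signs
  refine isSemialgebraic_of_signs (Finset.univ.biUnion F) fun x y h hx => ?_
  rw [Set.mem_iInter] at hx ⊢
  exact fun i => (hF i x y fun p hp => h p (Finset.mem_biUnion.2 ⟨i, by simp, hp⟩)).1 (hx i)

/-- The preimage of a semialgebraic set under a polynomial map is semialgebraic. -/
lemma IsSemialgebraic.preimage {S : Set (τ → ℝ)} (hS : IsSemialgebraic S)
    (g : τ → MvPolynomial σ ℝ) :
    IsSemialgebraic {x : σ → ℝ | (fun i => MvPolynomial.eval x (g i)) ∈ S} := by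
  classical
  obtain ⟨F, hF⟩ := hS.exists_signs
  refine isSemialgebraic_of_signs (F.image (MvPolynomial.bind₁ g)) fun x y h => (hF _ _ ?_).1
  intro p hp
  have := h _ (Finset.mem_image_of_mem _ hp)
  simpa only [MvPolynomial.eval, MvPolynomial.eval₂Hom_bind₁] using this

lemma IsSemialgebraic.preimage_comp {S : Set (τ → ℝ)} (hS : IsSemialgebraic S) (f : τ → σ) :
    IsSemialgebraic {x : σ → ℝ | x ∘ f ∈ S} := by
  simpa [Function.comp_def] using hS.preimage (σ := σ) fun i => MvPolynomial.X (f i)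

/-! ### Projection of semi-algebraic sets -/

/-- Projection along one coordinate. -/
lemma IsSemialgebraic.exists_option {S : Set (Option σ → ℝ)} (hS : IsSemialgebraic S) :
    IsSemialgebraic {x : σ → ℝ | ∃ t : ℝ, (fun o => Option.elim o t x) ∈ S} := by
  classical
  obtain ⟨F, hF⟩ := hS.exists_signs
  obtain ⟨T, hT⟩ := exists_signDetermined (F.val.map (MvPolynomial.optionEquivLeft ℝ σ))
  refine isSemialgebraic_of_signs T fun x y h => ?_
  rintro ⟨t, ht⟩
  -- The points `x` and `y` give two specializations of the coefficient ring; the witness `t` over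
  -- `x` becomes `φ t` over `y`.
  obtain ⟨φ, hφ⟩ := hT (MvPolynomial.eval x) (MvPolynomial.eval y) h
  refine ⟨φ t, (hF _ _ fun p hp => ?_).1 ht⟩
  rw [MvPolynomial.optionEquivLeft_elim_eval, MvPolynomial.optionEquivLeft_elim_eval]
  exact hφ _ (Multiset.mem_map_of_mem _ hp) t

/-- The Tarski–Seidenberg theorem. -/
lemma IsSemialgebraic.exists_sum (m : ℕ) : ∀ {σ : Type} {S : Set (σ ⊕ Fin m → ℝ)},
    IsSemialgebraic S → IsSemialgebraic {x : σ → ℝ | ∃ y : Fin m → ℝ, Sum.elim x y ∈ S} := by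
  induction m with
  | zero =>
    intro σ S hS
    convert hS.preimage_comp (fun i : σ ⊕ Fin 0 => i.elim id Fin.elim0) using 1
    ext x
    have : ∀ y : Fin 0 → ℝ, Sum.elim x y = x ∘ fun i : σ ⊕ Fin 0 => i.elim id Fin.elim0 := by
      intro y
      ext i
      rcases i with i | i
      · rfl
      · exact i.elim0
    simp [this]
  | succ m ih =>
    intro σ S hS
    let f : σ ⊕ Fin (m + 1) → Option (σ ⊕ Fin m) :=
      Sum.elim (fun i => some (Sum.inl i)) (Fin.cases none fun i => some (Sum.inr i))
    convert ih (hS.preimage_comp f).exists_option using 1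
    ext x
    have key : ∀ (t : ℝ) (y : Fin m → ℝ),
        (fun o : Option (σ ⊕ Fin m) => Option.elim o t (Sum.elim x y)) ∘ f =
          Sum.elim x (Fin.cons t y : Fin (m + 1) → ℝ) := by
      intro t y
      ext i
      rcases i with i | i
      · rfl
      · refine Fin.cases ?_ (fun j => ?_) i <;> rfl
    simp only [Set.mem_ofPred_eq, key]
    constructor
    · rintro ⟨y, hy⟩
      exact ⟨Fin.tail y, y 0, by rwa [Fin.cons_self_tail]⟩
    · rintro ⟨y, t, hy⟩
      exact ⟨_, hy⟩

lemma IsSemialgebraic.forall_sum {m : ℕ} {S : Set (σ ⊕ Fin m → ℝ)} (hS : IsSemialgebraic S) :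
    IsSemialgebraic {x : σ → ℝ | ∀ y : Fin m → ℝ, Sum.elim x y ∈ S} := by
  simpa [Set.compl_ofPred] using (IsSemialgebraic.exists_sum m hS.compl).compl

/-! ### Value functions are semi-algebraic -/

/-- A function with semialgebraic strict epigraph is semialgebraic. -/
lemma mem_SA_of_strictEpigraph {n : ℕ} {h : (Fin n → ℝ) → EReal}
    (hL : IsSemialgebraic {p : Fin n ⊕ Fin 1 → ℝ | h (p ∘ Sum.inl) < (p (Sum.inr 0) : EReal)}) :
    h ∈ SA n := by
  set L := {p : Fin n ⊕ Fin 1 → ℝ | h (p ∘ Sum.inl) < (p (Sum.inr 0) : EReal)} with hLdef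
  have hplus : IsSemialgebraic (domPlus h) := by
    convert hL.compl.forall_sum using 1
    ext x
    simp only [domPlus, hLdef, Set.mem_ofPred_eq, Set.mem_compl_iff, Sum.elim_inr, not_lt,
      Sum.elim_comp_inl, EReal.eq_top_iff_forall_lt]
    constructor
    · exact fun H y => (H (y 0)).le
    · intro H y
      refine lt_of_lt_of_le ?_ (H fun _ => y + 1)
      exact_mod_cast lt_add_one y
  have hminus : IsSemialgebraic (domMinus h) := by
    convert hL.forall_sum using 1
    ext x
    simp only [domMinus, hLdef, Set.mem_ofPred_eq, Sum.elim_inr, Sum.elim_comp_inl,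
      EReal.eq_bot_iff_forall_lt]
    exact ⟨fun H y => H (y 0), fun H y => H fun _ => y⟩
  refine ⟨?_, hplus, hminus, ?_⟩
  · convert (hplus.union hminus).compl using 1
    ext x
    simp [dom, domPlus, domMinus]
  -- A point `(x, t)` is on the graph iff `t ≤ h x` and every real `s > t` satisfies `h x < s`.
  · let S : Set ((Fin n ⊕ Fin 1) ⊕ Fin 1 → ℝ) :=
      {z | MvPolynomial.eval z (MvPolynomial.X (Sum.inr 0)) ≤
        MvPolynomial.eval z (MvPolynomial.X (Sum.inl (Sum.inr 0)))} ∪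
      {z | z ∘ Sum.elim (Sum.inl ∘ Sum.inl) Sum.inr ∈ L}
    have hS : IsSemialgebraic S := (isSemialgebraic_le _ _).union (hL.preimage_comp _)
    unfold IsSemialgebraicFun
    convert hL.compl.inter hS.forall_sum using 1
    ext p
    have hmem : (p ∈ Lᶜ ∩ {x | ∀ y, Sum.elim x y ∈ S}) ↔
        h (p ∘ Sum.inl) = (p (Sum.inr 0) : EReal) := by
      simp only [S, hLdef, Set.mem_inter_iff, Set.mem_compl_iff, Set.mem_ofPred_eq, not_lt,
        Set.mem_union, MvPolynomial.eval_X, Sum.elim_inr, Sum.elim_inl, Function.comp_apply]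
      have hc : ∀ y : Fin 1 → ℝ, (Sum.elim p y ∘ Sum.elim (Sum.inl ∘ Sum.inl) Sum.inr) ∘ Sum.inl =
          p ∘ (Sum.inl : Fin n → Fin n ⊕ Fin 1) := fun y => rfl
      simp only [hc]
      constructor
      · rintro ⟨h1, h2⟩
        refine le_antisymm ?_ h1
        refine EReal.le_of_forall_lt_iff_le.1 fun z hz => ?_
        rcases h2 fun _ => z with h3 | h3
        · exact absurd (EReal.coe_lt_coe_iff.1 hz) (not_lt.2 h3)
        · exact h3.le
      · intro he
        refine ⟨he.ge, fun y => ?_⟩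
        rw [he, EReal.coe_lt_coe_iff]
        exact le_or_gt _ _
    rw [hmem]
    constructor
    · rintro ⟨x, rfl⟩
      simpa using (EReal.coe_toReal x.2.1 x.2.2).symm
    · intro he
      refine ⟨⟨p ∘ Sum.inl, ?_⟩, ?_⟩
      · simp [dom, he]
      · ext i
        rcases i with i | i
        · rfl
        · simp [he, Subsingleton.elim i 0]

lemma isSemialgebraic_box {m : ℕ} (a b : Fin m → EReal) : IsSemialgebraic (box a b) := by
  have hlow : ∀ (c : EReal) (i : Fin m), IsSemialgebraic {y : Fin m → ℝ | c ≤ (y i : EReal)} := by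
    intro c i
    induction c with
    | bot => simpa using isSemialgebraic_univ
    | top => simpa using isSemialgebraic_empty
    | coe r => simpa using isSemialgebraic_le (MvPolynomial.C r) (MvPolynomial.X i)
  have hupp : ∀ (c : EReal) (i : Fin m), IsSemialgebraic {y : Fin m → ℝ | (y i : EReal) ≤ c} := by
    intro c i
    induction c with
    | bot => simpa using isSemialgebraic_empty
    | top => simpa using isSemialgebraic_univ
    | coe r => simpa using isSemialgebraic_le (MvPolynomial.X i) (MvPolynomial.C r)
  convert isSemialgebraic_iInter fun i => (hlow (a i) i).inter (hupp (b i) i) using 1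
  ext y
  simp [box]

/-- An infimum is `< t` iff some minimizer has `P < t`. The strict epigraph therefore needs no
attainment, and an empty `Θ(x)` needs no separate case. -/
lemma optimisticValue_mem_SA {n m : ℕ} (P Q : MvPolynomial (Fin n ⊕ Fin m) ℝ)
    {Y : Set (Fin m → ℝ)} (hY : IsSemialgebraic Y) : optimisticValue P Q Y ∈ SA n := by
  refine mem_SA_of_strictEpigraph ?_
  let f : Fin n ⊕ Fin m → (Fin n ⊕ Fin 1) ⊕ Fin m := Sum.elim (Sum.inl ∘ Sum.inl) Sum.inr
  let g : Fin n ⊕ Fin m → ((Fin n ⊕ Fin 1) ⊕ Fin m) ⊕ Fin m :=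
    Sum.elim (Sum.inl ∘ Sum.inl ∘ Sum.inl) Sum.inr
  let T : Set (((Fin n ⊕ Fin 1) ⊕ Fin m) ⊕ Fin m → ℝ) :=
    {z | z ∘ Sum.inr ∈ Y}ᶜ ∪ {z | MvPolynomial.eval z (MvPolynomial.rename (Sum.inl ∘ f) Q) ≤
      MvPolynomial.eval z (MvPolynomial.rename g Q)}
  have hT : IsSemialgebraic T := (hY.preimage_comp _).compl.union (isSemialgebraic_le _ _)
  let S : Set ((Fin n ⊕ Fin 1) ⊕ Fin m → ℝ) :=
    {z | z ∘ Sum.inr ∈ Y} ∩ {z | ∀ y', Sum.elim z y' ∈ T} ∩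
      {z | MvPolynomial.eval z (MvPolynomial.rename f P) <
        MvPolynomial.eval z (MvPolynomial.X (Sum.inl (Sum.inr 0)))}
  have hS : IsSemialgebraic S :=
    ((hY.preimage_comp _).inter hT.forall_sum).inter (isSemialgebraic_lt _ _)
  convert hS.exists_sum using 1
  ext p
  have h1 : ∀ y : Fin m → ℝ, Sum.elim p y ∘ f = Sum.elim (p ∘ Sum.inl) y := by
    intro y; ext i; rcases i with i | i <;> rfl
  have h2 : ∀ y y' : Fin m → ℝ, Sum.elim (Sum.elim p y) y' ∘ Sum.inl ∘ f =
      Sum.elim (p ∘ Sum.inl) y := by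
    intro y y'; ext i; rcases i with i | i <;> rfl
  have h3 : ∀ y y' : Fin m → ℝ, Sum.elim (Sum.elim p y) y' ∘ g = Sum.elim (p ∘ Sum.inl) y' := by
    intro y y'; ext i; rcases i with i | i <;> rfl
  simp only [S, T, optimisticValue, iInf_lt_iff, Set.mem_ofPred_eq, Set.mem_inter_iff,
    Set.mem_union, Set.mem_compl_iff, Sum.elim_comp_inr, MvPolynomial.eval_rename, h1, h2, h3,
    MvPolynomial.eval_X, Sum.elim_inl, EReal.coe_lt_coe_iff, lowerArgmin, exists_prop,
    ← imp_iff_not_or]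

lemma neg_mem_SA {n : ℕ} {h : (Fin n → ℝ) → EReal} (hh : h ∈ SA n) : (fun x => -h x) ∈ SA n := by
  obtain ⟨h1, h2, h3, h4⟩ := hh
  refine ⟨?_, ?_, ?_, ?_⟩
  · simpa [dom, and_comm] using h1
  · simpa [domPlus, domMinus] using h3
  · simpa [domPlus, domMinus] using h2
  · unfold IsSemialgebraicFun at h4 ⊢
    convert h4.preimage (σ := Fin n ⊕ Fin 1)
      (Sum.elim (fun i => MvPolynomial.X (Sum.inl i)) fun i => -MvPolynomial.X (Sum.inr i)) using 1
    ext p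
    constructor
    · rintro ⟨⟨x, hx⟩, rfl⟩
      refine ⟨⟨x, by simpa [dom, and_comm] using hx⟩, ?_⟩
      ext i
      rcases i with i | i <;> simp
    · rintro ⟨⟨x, hx⟩, he⟩
      refine ⟨⟨x, by simpa [dom, and_comm] using hx⟩, ?_⟩
      ext i
      have := congrFun he i
      rcases i with i | i
      · simpa using this
      · simpa [neg_eq_iff_eq_neg] using this

lemma ereal_neg_iSup {ι : Sort*} (f : ι → EReal) : -(⨆ i, f i) = ⨅ i, -f i := by
  refine le_antisymm (le_iInf fun i => EReal.neg_le_neg_iff.2 (le_iSup f i)) ?_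
  exact EReal.le_neg.2 (iSup_le fun i => EReal.le_neg.2 (iInf_le (fun i => -f i) i))

lemma pessimisticValue_eq_neg {n m : ℕ} (P Q : MvPolynomial (Fin n ⊕ Fin m) ℝ)
    (Y : Set (Fin m → ℝ)) :
    pessimisticValue P Q Y = fun x => -optimisticValue (-P) Q Y x := by
  ext x
  apply neg_injective
  rw [neg_neg]
  simp only [pessimisticValue, optimisticValue, map_neg, EReal.coe_neg, ereal_neg_iSup]

/-! ### Semi-algebraic sets as projected zero sets -/

/-- `S` is the projection of the zero set of a nonnegative polynomial. -/
def IsProjectedZeroSet (S : Set (σ → ℝ)) : Prop :=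
  ∃ (τ : Type) (_ : Fintype τ) (F : MvPolynomial (σ ⊕ τ) ℝ), (∀ z, 0 ≤ MvPolynomial.eval z F) ∧
    ∀ x, x ∈ S ↔ ∃ w : τ → ℝ, MvPolynomial.eval (Sum.elim x w) F = 0

/-- `q > 0` iff `q w² = 1` for some real `w`; summing squares merges all equations. -/
lemma IsBasicSemialgebraic.isProjectedZeroSet {S : Set (σ → ℝ)} (hS : IsBasicSemialgebraic S) :
    IsProjectedZeroSet S := by
  obtain ⟨k, P, Q, rfl⟩ := hS
  refine ⟨Fin k, inferInstance, (MvPolynomial.rename Sum.inl P) ^ 2 +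
    ∑ j, (MvPolynomial.rename Sum.inl (Q j) * MvPolynomial.X (Sum.inr j) ^ 2 - 1) ^ 2,
    fun z => ?_, fun x => ?_⟩
  · simp only [map_add, map_pow, map_sum]
    positivity
  · simp only [map_add, map_pow, map_sum, map_sub, map_mul, map_one, MvPolynomial.eval_X,
      Sum.elim_inr, MvPolynomial.eval_rename, Sum.elim_comp_inl, Set.mem_ofPred_eq]
    constructor
    · rintro ⟨h1, h2⟩
      refine ⟨fun j => (√(MvPolynomial.eval x (Q j)))⁻¹, ?_⟩
      rw [h1, Finset.sum_eq_zero]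
      · simp
      · intro j _
        rw [inv_pow, Real.sq_sqrt (h2 j).le, mul_inv_cancel₀ (h2 j).ne']
        simp
    · rintro ⟨w, hw⟩
      rw [add_eq_zero_iff_of_nonneg (sq_nonneg _) (Finset.sum_nonneg fun j _ => sq_nonneg _),
        Finset.sum_eq_zero_iff_of_nonneg fun j _ => sq_nonneg _] at hw
      refine ⟨by simpa using hw.1, fun j => ?_⟩
      have h := sub_eq_zero.1 (pow_eq_zero_iff two_ne_zero |>.1 (hw.2 j (Finset.mem_univ j)))
      exact pos_of_mul_pos_left (h ▸ one_pos) (sq_nonneg (w j))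

/-- A product vanishes iff a factor does; giving each factor its own auxiliary variables keeps the
witnesses independent. -/
lemma IsProjectedZeroSet.iUnion {N : ℕ} {B : Fin N → Set (σ → ℝ)}
    (hB : ∀ i, IsProjectedZeroSet (B i)) : IsProjectedZeroSet (⋃ i, B i) := by
  classical
  choose τ hτ F hF0 hF using hB
  have heval : ∀ (x : σ → ℝ) (w : (Σ i, τ i) → ℝ), MvPolynomial.eval (Sum.elim x w)
      (∏ i, MvPolynomial.rename (Sum.map id (Sigma.mk i)) (F i)) =
        ∏ i, MvPolynomial.eval (Sum.elim x fun j => w ⟨i, j⟩) (F i) := by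
    intro x w
    rw [map_prod]
    refine Finset.prod_congr rfl fun i _ => ?_
    rw [MvPolynomial.eval_rename]
    congr 2
    ext j
    rcases j with j | j <;> rfl
  refine ⟨Σ i, τ i, inferInstance, ∏ i, MvPolynomial.rename (Sum.map id (Sigma.mk i)) (F i),
    fun z => ?_, fun x => ?_⟩
  · rw [map_prod]
    refine Finset.prod_nonneg fun i _ => ?_
    rw [MvPolynomial.eval_rename]
    exact hF0 i _
  · simp only [heval, Finset.prod_eq_zero_iff, Finset.mem_univ, true_and, Set.mem_iUnion, hF]
    constructor
    · rintro ⟨i, w, hw⟩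
      refine ⟨fun s => if h : s.1 = i then w (h ▸ s.2) else 0, i, ?_⟩
      simpa using hw
    · rintro ⟨w, i, hw⟩
      exact ⟨i, _, hw⟩

lemma IsSemialgebraic.isProjectedZeroSet {S : Set (σ → ℝ)} (hS : IsSemialgebraic S) :
    IsProjectedZeroSet S := by
  obtain ⟨N, B, hB, rfl⟩ := hS
  exact .iUnion fun i => (hB i).isProjectedZeroSet

/-! ### Realizing semi-algebraic functions as value functions -/

/-- The polynomial `(uv - 1)² + u²` takes arbitrarily small positive values. -/
lemma exists_mul_sub_one_sq_add_sq_lt {ε : ℝ} (hε : 0 < ε) : ∃ u v : ℝ, (u * v - 1) ^ 2 + u ^ 2 < ε := by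
  refine ⟨√(ε / 2), (√(ε / 2))⁻¹, ?_⟩
  have : 0 < √(ε / 2) := Real.sqrt_pos.2 (by linarith)
  rw [mul_inv_cancel₀ this.ne', Real.sq_sqrt (by linarith)]
  linarith

lemma mul_sub_one_sq_add_sq_pos (u v : ℝ) : 0 < (u * v - 1) ^ 2 + u ^ 2 := by
  rcases eq_or_ne u 0 with rfl | hu
  · norm_num
  · have := sq_nonneg (u * v - 1)
    have : 0 < u ^ 2 := by positivity
    linarith

lemma exists_optimisticValue_eq {n : ℕ} {h : (Fin n → ℝ) → EReal} (hh : h ∈ SA n) :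
    ∃ (m : ℕ) (P Q : MvPolynomial (Fin n ⊕ Fin m) ℝ),
      0 < m ∧ optimisticValue P Q Set.univ = h := by
  obtain ⟨-, -, hminus, hgraph⟩ := hh
  obtain ⟨τ, _, F, hF0, hF⟩ :=
    (hgraph.union (hminus.preimage_comp (Sum.inl : Fin n → Fin n ⊕ Fin 1))).isProjectedZeroSet
  have hF' : ∀ (x : Fin n → ℝ) (t : ℝ),
      (∃ w : τ → ℝ, MvPolynomial.eval (Sum.elim (Sum.elim x fun _ => t) w) F = 0) ↔
        h x = t ∨ h x = ⊥ := by
    intro x t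
    rw [← hF]
    refine or_congr ?_ ?_
    · constructor
      · rintro ⟨y, hy⟩
        have h1 : x = y := by
          ext i; exact congrFun hy (Sum.inl i)
        have h2 : t = (h y).toReal := congrFun hy (Sum.inr 0)
        rw [h2, h1, EReal.coe_toReal y.2.1 y.2.2]
      · intro he
        exact ⟨⟨x, by simp [dom, he]⟩, by simp [he]⟩
    · simp [domMinus]
  let e : (Fin 1 ⊕ τ) ⊕ Fin 2 ≃ Fin (Fintype.card ((Fin 1 ⊕ τ) ⊕ Fin 2)) := Fintype.equivFin _
  let u := e (Sum.inr 0)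
  let v := e (Sum.inr 1)
  let f : (Fin n ⊕ Fin 1) ⊕ τ → Fin n ⊕ Fin (Fintype.card ((Fin 1 ⊕ τ) ⊕ Fin 2)) :=
    Sum.elim (Sum.elim Sum.inl fun i => Sum.inr (e (Sum.inl (Sum.inl i))))
      fun j => Sum.inr (e (Sum.inl (Sum.inr j)))
  let P : MvPolynomial (Fin n ⊕ Fin (Fintype.card ((Fin 1 ⊕ τ) ⊕ Fin 2))) ℝ :=
    MvPolynomial.X (Sum.inr (e (Sum.inl (Sum.inl 0))))
  let Q : MvPolynomial (Fin n ⊕ Fin (Fintype.card ((Fin 1 ⊕ τ) ⊕ Fin 2))) ℝ :=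
    MvPolynomial.rename f F * ((MvPolynomial.X (Sum.inr u) * MvPolynomial.X (Sum.inr v) - 1) ^ 2 +
      MvPolynomial.X (Sum.inr u) ^ 2)
  let E : (Fin n → ℝ) → ℝ → (τ → ℝ) → ℝ := fun x t w =>
    MvPolynomial.eval (Sum.elim (Sum.elim x fun _ => t) w) F
  have hQ : ∀ x y, MvPolynomial.eval (Sum.elim x y) Q =
      E x (y (e (Sum.inl (Sum.inl 0)))) (fun j => y (e (Sum.inl (Sum.inr j)))) *
        ((y u * y v - 1) ^ 2 + y u ^ 2) := by
    intro x y
    simp only [Q, E, map_mul, map_add, map_pow, map_sub, map_one, MvPolynomial.eval_X,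
      Sum.elim_inr, MvPolynomial.eval_rename]
    congr 3
    ext i
    rcases i with (i | i) | i
    · rfl
    · simp [f, Subsingleton.elim i 0]
    · rfl
  have hpoint : ∀ (t : ℝ) (w : τ → ℝ) (a b : ℝ), ∃ y : Fin (Fintype.card ((Fin 1 ⊕ τ) ⊕ Fin 2)) → ℝ,
      y (e (Sum.inl (Sum.inl 0))) = t ∧ (fun j => y (e (Sum.inl (Sum.inr j)))) = w ∧
        y u = a ∧ y v = b := fun t w a b =>
    ⟨fun i => Sum.elim (Sum.elim (fun _ => t) w) ![a, b] (e.symm i), by simp [u, v]⟩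
  have hargmin : ∀ x y, y ∈ lowerArgmin Q Set.univ x ↔
      E x (y (e (Sum.inl (Sum.inl 0)))) (fun j => y (e (Sum.inl (Sum.inr j)))) = 0 := by
    intro x y
    simp only [lowerArgmin, Set.mem_univ, true_and, true_imp_iff, Set.mem_ofPred_eq, hQ]
    constructor
    · intro hmin
      by_contra hne
      have hpos := (hF0 _).lt_of_ne' hne
      -- Keeping `(t, w)` and shrinking the second factor lowers `Q` strictly, since `F > 0`.
      obtain ⟨a, b, hab⟩ := exists_mul_sub_one_sq_add_sq_lt (mul_sub_one_sq_add_sq_pos (y u) (y v))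
      obtain ⟨y', h1, h2, h3, h4⟩ := hpoint (y (e (Sum.inl (Sum.inl 0))))
        (fun j => y (e (Sum.inl (Sum.inr j)))) a b
      have := hmin y'
      rw [h1, h2, h3, h4] at this
      exact absurd (le_of_mul_le_mul_left this hpos) (not_le.2 hab)
    · intro h0 y'
      rw [h0, zero_mul]
      exact mul_nonneg (hF0 _) (mul_sub_one_sq_add_sq_pos _ _).le
  refine ⟨_, P, Q, Fintype.card_pos, funext fun x => ?_⟩
  have hP : ∀ y, MvPolynomial.eval (Sum.elim x y) P = y (e (Sum.inl (Sum.inl 0))) := by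
    intro y; simp [P]
  have hval : ∀ y ∈ lowerArgmin Q Set.univ x,
      h x = (y (e (Sum.inl (Sum.inl 0))) : ℝ) ∨ h x = ⊥ := fun y hy =>
    (hF' x _).1 ⟨_, (hargmin x y).1 hy⟩
  have hattain : ∀ t : ℝ, h x = t ∨ h x = ⊥ → optimisticValue P Q Set.univ x ≤ t := by
    intro t ht
    obtain ⟨w, hw⟩ := (hF' x t).2 ht
    -- On the zero set of `F` the values of `u` and `v` are irrelevant.
    obtain ⟨y, h1, h2, -, -⟩ := hpoint t w 0 0
    have hy : y ∈ lowerArgmin Q Set.univ x := by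
      rw [hargmin, h1, h2]; exact hw
    refine (iInf₂_le y hy).trans ?_
    rw [hP, h1]
  refine le_antisymm ?_ (le_iInf₂ fun y hy => ?_)
  · induction hx : h x with
    | bot => exact (EReal.eq_bot_iff_forall_lt _).2 (fun t =>
        (hattain (t - 1) (Or.inr hx)).trans_lt (by exact_mod_cast sub_one_lt t)) |>.le
    | top => exact le_top
    | coe t => exact hattain t (Or.inl hx)
  · rw [hP]
    rcases hval y hy with h1 | h1 <;> simp [h1]

lemma exists_pessimisticValue_eq {n : ℕ} {h : (Fin n → ℝ) → EReal} (hh : h ∈ SA n) :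
    ∃ (m : ℕ) (P Q : MvPolynomial (Fin n ⊕ Fin m) ℝ),
      0 < m ∧ pessimisticValue P Q Set.univ = h := by
  obtain ⟨m, P, Q, hm, he⟩ := exists_optimisticValue_eq (neg_mem_SA hh)
  exact ⟨m, -P, Q, hm, by simp [pessimisticValue_eq_neg, he]⟩

lemma pessimisticValue_mem_SA {n m : ℕ} (P Q : MvPolynomial (Fin n ⊕ Fin m) ℝ)
    {Y : Set (Fin m → ℝ)} (hY : IsSemialgebraic Y) : pessimisticValue P Q Y ∈ SA n := by
  rw [pessimisticValue_eq_neg]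
  exact neg_mem_SA (optimisticValue_mem_SA _ _ hY)

lemma box_bot_top {m : ℕ} : box (fun _ : Fin m => ⊥) (fun _ => ⊤) = Set.univ := by
  simp [box]

lemma POptimUnbound_eq_SA (n : ℕ) : POptimUnbound n = SA n := by
  refine Set.Subset.antisymm ?_ fun h hh => ?_
  · rintro _ ⟨m, P, Q, a, b, -, rfl⟩
    exact optimisticValue_mem_SA P Q (isSemialgebraic_box a b)
  · obtain ⟨m, P, Q, hm, he⟩ := exists_optimisticValue_eq hh
    exact ⟨m, P, Q, fun _ => ⊥, fun _ => ⊤, ⟨⟨0, hm⟩, Or.inl rfl⟩, by rw [box_bot_top, he]⟩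

lemma PPessimUnbound_eq_SA (n : ℕ) : PPessimUnbound n = SA n := by
  refine Set.Subset.antisymm ?_ fun h hh => ?_
  · rintro _ ⟨m, P, Q, a, b, -, rfl⟩
    exact pessimisticValue_mem_SA P Q (isSemialgebraic_box a b)
  · obtain ⟨m, P, Q, hm, he⟩ := exists_pessimisticValue_eq hh
    exact ⟨m, P, Q, fun _ => ⊥, fun _ => ⊤, ⟨⟨0, hm⟩, Or.inl rfl⟩, by rw [box_bot_top, he]⟩

end PolyBilevel

theorem mainTheorem1 (n : ℕ) :
    (∀ h ∈ PolyBilevel.SA n,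
      (∃ (m : ℕ) (P Q : MvPolynomial (Fin n ⊕ Fin m) ℝ),
        0 < m ∧ PolyBilevel.optimisticValue P Q Set.univ = h) ∧
      (∃ (m : ℕ) (P Q : MvPolynomial (Fin n ⊕ Fin m) ℝ),
        0 < m ∧ PolyBilevel.pessimisticValue P Q Set.univ = h)) ∧
    PolyBilevel.POptimUnbound n = PolyBilevel.PPessimUnbound n ∧
    PolyBilevel.PPessimUnbound n = PolyBilevel.SA n :=
  ⟨fun _ hh => ⟨PolyBilevel.exists_optimisticValue_eq hh,
      PolyBilevel.exists_pessimisticValue_eq hh⟩,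
    (PolyBilevel.POptimUnbound_eq_SA n).trans (PolyBilevel.PPessimUnbound_eq_SA n).symm,
    PolyBilevel.PPessimUnbound_eq_SA n⟩
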